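/- Let $A$ be a $2\times 2$ integer matrix such that $\det A\neq 0$ and no (complex) eigenvalue of $A$ is a root of unity. Let $\mathbb T^2=\mathbb R^2/\mathbb Z^2$ carry its normalized Haar measure $dx$, and let $f\in L^2(\mathbb T^2,dx)$ be complex-valued, with Fourier coefficients $\widehat f(\xi)=\int_{\mathbb T^2} f(x)e^{-2\pi i\, x\cdot\xi}\,dx$, $\xi\in\mathbb Z^2$. Assume that for some $\delta>0$ $$\sum_{\xi\in\mathbb Z^2}\bigl(\log(1+|\xi|)\bigr)^{1+\delta}\,|\widehat f(\xi)|^2<+\infty,$$ where $|\xi|$ is the Euclidean norm of $\xi$. Then, for every $\eta>0$ and for almost every $x\in\mathbb T^2$, $$\lim_{N\to+\infty}\frac{\sqrt N}{(\log(1+N))^{\frac32+\eta}}\,\Bigl|\frac1N\sum_{n=0}^{N-1}f(A^nx)-\int_{\mathbb T^2}f(y)\,dy\Bigr|=0.$$ -/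

import Mathlib

open MeasureTheory Filter Topology

/-- The Haar probability measure `dx` on the two-dimensional torus `𝕋² = ℝ²/ℤ²`, as the product of
the Haar probability measures of the two circles `ℝ/ℤ` (this is also the measure with respect to
which `UnitAddTorus.mFourierCoeff` is defined). -/
noncomputable abbrev torusMeasure : Measure (UnitAddTorus (Fin 2)) :=
  Measure.pi fun _ => AddCircle.haarAddCircle

/-- The endomorphism `x ↦ B x` of `𝕋²` induced by an integer matrix `B`. -/
def toralMap (B : Matrix (Fin 2) (Fin 2) ℤ) (x : UnitAddTorus (Fin 2)) : UnitAddTorus (Fin 2) :=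
  fun i => ∑ j, B i j • x j

/-- The Euclidean norm `|ξ|` of a frequency `ξ ∈ ℤ²`. -/
noncomputable def latticeNorm (ξ : Fin 2 → ℤ) : ℝ :=
  √(∑ i, (ξ i : ℝ) ^ 2)

/-- No complex eigenvalue of the integer matrix `A` is a root of unity. -/
def NoRootOfUnityEigenvalue (A : Matrix (Fin 2) (Fin 2) ℤ) : Prop :=
  ∀ z : ℂ, Module.End.HasEigenvalue (Matrix.toLin' (A.map (Int.cast : ℤ → ℂ))) z →
    ∀ k : ℕ, 0 < k → z ^ k ≠ 1

/-! Subtract the mean, so that g = f - ∫ f has no zero frequency. Composition with A^n moves the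
Fourier coefficient at ζ to (Aᵀ)^n ζ. No eigenvalue of A lies on the unit circle, because an
algebraic integer of degree at most two and modulus one is a root of unity. An orbit of nonzero
lattice vectors is therefore exponentially small in its middle compared with its ends; as its
vectors have norm at least 1, log(1 + |(Aᵀ)^n ζ|) grows linearly in the distance from the time of
smallest norm (`exists_log_orbit_lower_bound`). Hence the inverse weights log^{-(1+δ)} have bounded
sums along orbits, uniformly in ζ (`exists_sum_inv_log_rpow_le`).

Cauchy–Schwarz with these weights at each frequency, then Parseval, give ∫ |∑_{n ∈ F} g ∘ A^n|² ≤ C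
|F| for every finite F (`exists_integral_sq_orbit_sum_le`). The Rademacher–Menshov dyadic argument
turns this into the almost everywhere rate (`ae_tendsto_of_integral_sq_sum_le`). -/

/-! ### Linear recurrences of order two with hyperbolic roots. -/

/-- A sequence expanding by a factor `‖a‖` at each step. -/
lemma norm_le_of_geometric {E : Type*} [NormedAddCommGroup E] [NormedSpace ℂ E] {a : ℂ} {y : ℕ → E}
    (hy : ∀ n, y (n + 1) = a • y n) (n k : ℕ) : ‖y (n + k)‖ = ‖a‖ ^ k * ‖y n‖ := by
  induction k with
  | zero => simp
  | succ k ih => rw [← add_assoc, hy, norm_smul, ih]; ring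

/-- Filtering out the root b leaves a geometric sequence of ratio a. This replaces diagonalization
and still works when a = b. -/
lemma geometric_left_of_recurrence {E : Type*} [NormedAddCommGroup E] [NormedSpace ℂ E] {a b : ℂ}
    {x : ℕ → E} (hx : ∀ n, x (n + 2) = (a + b) • x (n + 1) - (a * b) • x n) (n : ℕ) :
    x (n + 1 + 1) - b • x (n + 1) = a • (x (n + 1) - b • x n) := by
  rw [show n + 1 + 1 = n + 2 from rfl, hx]; module

/-- If both characteristic roots of a linear recurrence of order two have modulus greater than one,
then its solutions of bounded growth expand exponentially. -/
lemma exists_expansion {a b : ℂ} (ha : 1 < ‖a‖) (hb : 1 < ‖b‖) (hab : ‖b‖ ≤ ‖a‖) {L : ℝ}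
    (hL : 0 ≤ L) :
    ∃ C ρ : ℝ, 0 < C ∧ 0 < ρ ∧ ρ < 1 ∧ ∀ {E : Type} [NormedAddCommGroup E] [NormedSpace ℂ E]
      (x : ℕ → E), (∀ n, x (n + 2) = (a + b) • x (n + 1) - (a * b) • x n) →
      (∀ n, ‖x (n + 1)‖ ≤ L * ‖x n‖) → ∀ n l, ‖x n‖ ≤ C * ρ ^ l * ‖x (n + l)‖ := by
  have hb0 : 0 < ‖b‖ := one_pos.trans hb
  set K := L + ‖b‖ with hK
  have hK0 : 0 < K := by positivity
  -- Half of the decay rate ‖b‖⁻¹ = r² is sacrificed to absorb the linear factor l in `key`.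
  set r := √(‖b‖⁻¹) with hr
  have hr0 : 0 < r := by positivity
  have hrr : r ^ 2 = ‖b‖⁻¹ := Real.sq_sqrt (by positivity)
  have hr1 : r < 1 := by
    rw [hr, Real.sqrt_lt' one_pos]; simpa using inv_lt_one_of_one_lt₀ hb
  obtain ⟨D, hD⟩ : BddAbove (Set.range fun l : ℕ => (l : ℝ) * r ^ l) :=
    (tendsto_self_mul_const_pow_of_lt_one hr0.le hr1).bddAbove_range
  have hD' : ∀ l : ℕ, (l : ℝ) * r ^ l ≤ D := fun l => hD ⟨l, rfl⟩
  have hD0 : 0 ≤ D := by simpa using hD' 0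
  refine ⟨1 + D * K, r, by positivity, hr0, hr1, ?_⟩
  intro E _ _ x hx hxL
  have hyK : ∀ n, ‖x (n + 1) - b • x n‖ ≤ K * ‖x n‖ := fun n => by
    refine (norm_sub_le _ _).trans ?_
    rw [norm_smul, hK, add_mul]
    gcongr
    exact hxL n
  have hy := geometric_left_of_recurrence hx
  -- The factor 1 + l K is of the order forced by a Jordan block when a = b.
  have key : ∀ l n, ‖b‖ ^ l * ‖x n‖ ≤ (1 + l * K) * ‖x (n + l)‖ := by
    intro l
    induction l with
    | zero => intro n; simp
    | succ l ih =>
      intro n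
      have h1 : ‖b‖ * ‖x n‖ ≤ ‖x (n + 1)‖ + ‖x (n + 1) - b • x n‖ := by
        rw [← norm_smul]
        calc ‖b • x n‖ = ‖x (n + 1) - (x (n + 1) - b • x n)‖ := by congr 1; abel
          _ ≤ _ := norm_sub_le _ _
      have h2 : ‖b‖ ^ l * ‖x (n + 1) - b • x n‖ ≤ K * ‖x (n + (l + 1))‖ := by
        calc ‖b‖ ^ l * ‖x (n + 1) - b • x n‖ ≤ ‖a‖ ^ (l + 1) * ‖x (n + 1) - b • x n‖ := by
              gcongr ?_ * _
              calc ‖b‖ ^ l ≤ ‖a‖ ^ l := by gcongr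
                _ ≤ ‖a‖ ^ (l + 1) := pow_le_pow_right₀ ha.le (Nat.le_succ l)
          _ = ‖x (n + (l + 1) + 1) - b • x (n + (l + 1))‖ :=
              (norm_le_of_geometric (y := fun n => x (n + 1) - b • x n) hy n (l + 1)).symm
          _ ≤ _ := hyK _
      have h3 := ih (n + 1)
      rw [show n + 1 + l = n + (l + 1) by ring] at h3
      calc ‖b‖ ^ (l + 1) * ‖x n‖ = ‖b‖ ^ l * (‖b‖ * ‖x n‖) := by ring
        _ ≤ ‖b‖ ^ l * (‖x (n + 1)‖ + ‖x (n + 1) - b • x n‖) := by gcongr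
        _ ≤ (1 + l * K) * ‖x (n + (l + 1))‖ + K * ‖x (n + (l + 1))‖ := by
            rw [mul_add]; exact add_le_add h3 h2
        _ = _ := by push_cast; ring
  intro n l
  have hbl : ‖b‖ ^ l * (r ^ l * r ^ l) = 1 := by
    rw [← mul_pow, ← mul_pow, ← sq, hrr, mul_inv_cancel₀ hb0.ne', one_pow]
  calc ‖x n‖ = (r ^ l * r ^ l) * (‖b‖ ^ l * ‖x n‖) := by
        rw [← mul_assoc, mul_comm (r ^ l * r ^ l), hbl, one_mul]
    _ ≤ (r ^ l * r ^ l) * ((1 + l * K) * ‖x (n + l)‖) :=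
        mul_le_mul_of_nonneg_left (key l n) (by positivity)
    _ = (r ^ l + (l * r ^ l) * K) * r ^ l * ‖x (n + l)‖ := by ring
    _ ≤ (1 + D * K) * r ^ l * ‖x (n + l)‖ := by
        gcongr
        · exact pow_le_one₀ hr0.le hr1.le
        · exact hD' l

/-- Convexity bound for a linear recurrence of order two whose characteristic roots lie on both
sides of the unit circle. -/
lemma exists_saddle_bound {a b : ℂ} (ha : 1 < ‖a‖) (hb : ‖b‖ < 1) {L : ℝ} (hL : 0 ≤ L) :
    ∃ C ρ : ℝ, 0 < C ∧ 0 < ρ ∧ ρ < 1 ∧ ∀ {E : Type} [NormedAddCommGroup E] [NormedSpace ℂ E]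
      (x : ℕ → E), (∀ n, x (n + 2) = (a + b) • x (n + 1) - (a * b) • x n) →
      (∀ n, ‖x (n + 1)‖ ≤ L * ‖x n‖) →
      ∀ n k l, ‖x (n + k)‖ ≤ C * (ρ ^ k * ‖x n‖ + ρ ^ l * ‖x (n + k + l)‖) := by
  have ha0 : 0 < ‖a‖ := one_pos.trans ha
  have hab : 0 < ‖a - b‖ := by
    rw [norm_pos_iff, sub_ne_zero]; rintro rfl; exact absurd ha hb.le.not_gt
  set K := L + ‖a‖ with hK
  have hK0 : 0 < K := by positivity
  have hyK : ∀ {E : Type} [NormedAddCommGroup E] [NormedSpace ℂ E] (x : ℕ → E),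
      (∀ n, ‖x (n + 1)‖ ≤ L * ‖x n‖) → ∀ c : ℂ, ‖c‖ ≤ ‖a‖ → ∀ n,
      ‖x (n + 1) - c • x n‖ ≤ K * ‖x n‖ := fun x hxL c hc n => by
    refine (norm_sub_le _ _).trans ?_
    rw [norm_smul, hK, add_mul]
    gcongr
    exact hxL n
  set ρ := max ‖a‖⁻¹ ‖b‖ with hρ
  have hρ0 : 0 < ρ := lt_max_of_lt_left (by positivity)
  have hρ1 : ρ < 1 := max_lt (inv_lt_one_of_one_lt₀ ha) hb
  refine ⟨K / ‖a - b‖, ρ, by positivity, hρ0, hρ1, ?_⟩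
  intro E _ _ x hx hxL n k l
  -- (a - b) x is the difference of the two filtered sequences: the one of ratio a is controlled
  -- from the future, the one of ratio b from the past.
  have hy := norm_le_of_geometric (y := fun n => x (n + 1) - b • x n)
    (geometric_left_of_recurrence hx) (n + k) l
  have hz := norm_le_of_geometric (y := fun n => x (n + 1) - a • x n)
    (geometric_left_of_recurrence (a := b) (b := a)
      (fun n => by rw [hx, add_comm a, mul_comm a])) n k
  have hy2 : ‖x (n + k + 1) - b • x (n + k)‖ ≤ ρ ^ l * (K * ‖x (n + k + l)‖) := by
    have h1 := hyK x hxL b (hb.le.trans ha.le) (n + k + l)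
    rw [hy] at h1
    calc ‖x (n + k + 1) - b • x (n + k)‖
        = ‖a‖⁻¹ ^ l * (‖a‖ ^ l * ‖x (n + k + 1) - b • x (n + k)‖) := by
          rw [← mul_assoc, ← mul_pow, inv_mul_cancel₀ ha0.ne', one_pow, one_mul]
      _ ≤ ρ ^ l * (K * ‖x (n + k + l)‖) := by gcongr; exact le_max_left _ _
  have hz2 : ‖x (n + k + 1) - a • x (n + k)‖ ≤ ρ ^ k * (K * ‖x n‖) := by
    rw [hz]
    gcongr
    · exact le_max_right _ _
    · exact hyK x hxL a le_rfl n
  have h3 : ‖a - b‖ * ‖x (n + k)‖ ≤ ρ ^ k * (K * ‖x n‖) + ρ ^ l * (K * ‖x (n + k + l)‖) := by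
    rw [← norm_smul]
    calc ‖(a - b) • x (n + k)‖
        = ‖(x (n + k + 1) - b • x (n + k)) - (x (n + k + 1) - a • x (n + k))‖ := by
          congr 1; module
      _ ≤ _ := norm_sub_le _ _
      _ ≤ _ := by linarith
  rw [div_mul_eq_mul_div, le_div_iff₀ hab]
  linarith

/-- The saddle bound also covers the expanding case, where the past term is superfluous. -/
lemma exists_hyperbolic_bound {a b : ℂ} (ha : 1 < ‖a‖) (hb : ‖b‖ ≠ 1) (hba : ‖b‖ ≤ ‖a‖) {L : ℝ}
    (hL : 0 ≤ L) :
    ∃ C ρ : ℝ, 0 < C ∧ 0 < ρ ∧ ρ < 1 ∧ ∀ {E : Type} [NormedAddCommGroup E] [NormedSpace ℂ E]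
      (x : ℕ → E), (∀ n, x (n + 2) = (a + b) • x (n + 1) - (a * b) • x n) →
      (∀ n, ‖x (n + 1)‖ ≤ L * ‖x n‖) →
      ∀ n k l, ‖x (n + k)‖ ≤ C * (ρ ^ k * ‖x n‖ + ρ ^ l * ‖x (n + k + l)‖) := by
  rcases lt_or_gt_of_ne hb with hb | hb
  · exact exists_saddle_bound ha hb hL
  · obtain ⟨C, ρ, hC, h0, h1, h⟩ := exists_expansion ha hb hba hL
    refine ⟨C, ρ, hC, h0, h1, fun x hx hxL n k l => ?_⟩
    calc _ ≤ C * ρ ^ l * ‖x (n + k + l)‖ := h x hx hxL _ _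
      _ ≤ C * (ρ ^ k * ‖x n‖ + ρ ^ l * ‖x (n + k + l)‖) := by
        rw [mul_assoc]; gcongr; exact le_add_of_nonneg_left (by positivity)

/-! ### Eigenvalues of A off the unit circle. -/

/-- A complex root of unit modulus of an integer quadratic `X² - tX + d` is a root of unity. -/
lemma exists_pow_eq_one_of_norm_eq_one {t d : ℤ} {z : ℂ} (hz : z ^ 2 - t * z + d = 0)
    (h1 : ‖z‖ = 1) : ∃ k : ℕ, 0 < k ∧ z ^ k = 1 := by
  have hzc : z * (starRingEnd ℂ) z = 1 := by
    rw [Complex.mul_conj, Complex.normSq_eq_norm_sq, h1]; simp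
  have hc : (starRingEnd ℂ) z ^ 2 - t * (starRingEnd ℂ) z + d = 0 := by
    have := congrArg (starRingEnd ℂ) hz
    simpa using this
  set w := (starRingEnd ℂ) z with hw
  have real_case : w = z → z ^ 2 = 1 := fun h => by rw [h] at hzc; rw [sq, hzc]
  by_cases hne : w = z
  · exact ⟨2, two_pos, real_case hne⟩
  have ht : z + w = t := by
    have : (z - w) * (z + w - t) = 0 := by linear_combination hz - hc
    rcases mul_eq_zero.1 this with h | h
    · exact absurd (sub_eq_zero.1 h).symm hne
    · exact sub_eq_zero.1 h
  have hd : (d : ℂ) = 1 := by linear_combination hz - z * ht + hzc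
  rw [hd] at hz
  have hre : (t : ℝ) = 2 * z.re := by
    have := congrArg Complex.re ht
    simp [hw] at this; linarith
  have hab : |z.re| ≤ 1 := h1 ▸ Complex.abs_re_le_norm z
  have hlow : -2 ≤ t := by
    have := (abs_le.1 hab).1
    exact_mod_cast (by linarith : (-2 : ℝ) ≤ t)
  have hhigh : t ≤ 2 := by
    have := (abs_le.1 hab).2
    exact_mod_cast (by linarith : (t : ℝ) ≤ 2)
  -- With d = 1 and |t| ≤ 2, the possible orders are 1, 2, 3, 4, 6, whose least common multiple is
  -- 12.
  refine ⟨12, by norm_num, ?_⟩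
  interval_cases t
  · have : (z + 1) ^ 2 = 0 := by push_cast at hz; linear_combination hz
    have : z = -1 := by linear_combination pow_eq_zero_iff (two_ne_zero) |>.1 this
    rw [this]; norm_num
  · push_cast at hz
    have : z ^ 3 = 1 := by linear_combination (z - 1) * hz
    rw [show 12 = 3 * 4 from rfl, pow_mul, this, one_pow]
  · push_cast at hz
    have : z ^ 4 = 1 := by linear_combination (z ^ 2 - 1) * hz
    rw [show 12 = 4 * 3 from rfl, pow_mul, this, one_pow]
  · push_cast at hz
    have : z ^ 6 = 1 := by linear_combination (z ^ 3 - 1) * (z + 1) * hz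
    rw [show 12 = 6 * 2 from rfl, pow_mul, this, one_pow]
  · have : (z - 1) ^ 2 = 0 := by push_cast at hz; linear_combination hz
    have : z = 1 := by linear_combination pow_eq_zero_iff (two_ne_zero) |>.1 this
    rw [this]; norm_num

lemma exists_hyperbolic_eigenvalues {A : Matrix (Fin 2) (Fin 2) ℤ} (hdet : A.det ≠ 0)
    (hA : NoRootOfUnityEigenvalue A) :
    ∃ a b : ℂ, a + b = A.trace ∧ a * b = A.det ∧ 1 < ‖a‖ ∧ ‖b‖ ≠ 1 ∧ ‖b‖ ≤ ‖a‖ := by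
  have hroot : ∀ z : ℂ, z ^ 2 - A.trace * z + A.det = 0 → ‖z‖ ≠ 1 := by
    intro z hz h1
    obtain ⟨k, hk, hzk⟩ := exists_pow_eq_one_of_norm_eq_one hz h1
    refine hA z ?_ k hk hzk
    rw [Module.End.hasEigenvalue_iff_isRoot_charpoly, Matrix.charpoly_toLin',
      Matrix.charpoly_fin_two]
    simp only [Polynomial.IsRoot, Polynomial.eval_add, Polynomial.eval_sub, Polynomial.eval_mul,
      Polynomial.eval_pow, Polynomial.eval_X, Polynomial.eval_C]
    rw [Matrix.trace_fin_two, Matrix.det_fin_two] at *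
    push_cast at hz
    simpa using hz
  obtain ⟨s, hs⟩ := IsAlgClosed.exists_pow_nat_eq ((A.trace : ℂ) ^ 2 - 4 * A.det) two_pos
  obtain ⟨a, b, hsum, hprod, hba⟩ :
      ∃ a b : ℂ, a + b = A.trace ∧ a * b = A.det ∧ ‖b‖ ≤ ‖a‖ := by
    rcases le_total ‖((A.trace : ℂ) + s) / 2‖ ‖((A.trace : ℂ) - s) / 2‖ with h | h
    · exact ⟨_, _, by ring, by linear_combination -hs / 4, h⟩
    · exact ⟨_, _, by ring, by linear_combination -hs / 4, h⟩
  have hb := hroot b (by rw [← hsum, ← hprod]; ring)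
  have ha := hroot a (by rw [← hsum, ← hprod]; ring)
  refine ⟨a, b, hsum, hprod, lt_of_le_of_ne ?_ ha.symm, hb, hba⟩
  -- Otherwise both roots lie in the unit disc, a strictly inside, against |ab| = |det A| ≥ 1.
  by_contra! hlt
  have h1 : (1 : ℝ) ≤ ‖a‖ * ‖b‖ := by
    rw [← norm_mul, hprod, Complex.norm_intCast]
    exact_mod_cast Int.one_le_abs hdet
  have : ‖a‖ * ‖b‖ ≤ ‖a‖ * 1 := by gcongr; exact hba.trans hlt.le
  linarith

/-! ### Growth of orbits of lattice vectors. -/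

lemma latticeNorm_eq_norm (ξ : Fin 2 → ℤ) :
    latticeNorm ξ = ‖WithLp.toLp 2 (fun i => (ξ i : ℂ))‖ := by
  simp [latticeNorm, EuclideanSpace.norm_eq, Complex.norm_intCast]

lemma one_le_latticeNorm {ξ : Fin 2 → ℤ} (hξ : ξ ≠ 0) : 1 ≤ latticeNorm ξ := by
  obtain ⟨i, hi⟩ := Function.ne_iff.1 hξ
  rw [latticeNorm, Real.one_le_sqrt]
  have h1 : (1 : ℝ) ≤ (ξ i : ℝ) ^ 2 := by
    have : 0 < ξ i ^ 2 := by have : ξ i ≠ 0 := hi; positivity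
    exact_mod_cast this
  exact h1.trans (Finset.single_le_sum (f := fun i => (ξ i : ℝ) ^ 2)
    (fun _ _ => sq_nonneg _) (Finset.mem_univ i))

/-- By Cayley–Hamilton the orbit in ℂ² satisfies the recurrence with roots a and b; the operator
norm of Aᵀ bounds one-step growth. -/
lemma exists_latticeNorm_orbit_bound {A : Matrix (Fin 2) (Fin 2) ℤ} (hdet : A.det ≠ 0)
    (hA : NoRootOfUnityEigenvalue A) :
    ∃ C ρ : ℝ, 0 < C ∧ 0 < ρ ∧ ρ < 1 ∧ ∀ (ζ : Fin 2 → ℤ) (n k l : ℕ),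
      latticeNorm ((A.transpose ^ (n + k)).mulVec ζ) ≤
        C * (ρ ^ k * latticeNorm ((A.transpose ^ n).mulVec ζ) +
          ρ ^ l * latticeNorm ((A.transpose ^ (n + k + l)).mulVec ζ)) := by
  obtain ⟨a, b, hsum, hprod, ha, hb, hba⟩ := exists_hyperbolic_eigenvalues hdet hA
  set B := A.transpose with hB
  set T := Matrix.toEuclideanCLM (n := Fin 2) (𝕜 := ℂ) (B.map (Int.cast : ℤ → ℂ)) with hT
  obtain ⟨C, ρ, hC, h0, h1, h⟩ := exists_hyperbolic_bound ha hb hba (norm_nonneg T)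
  refine ⟨C, ρ, hC, h0, h1, fun ζ => ?_⟩
  simp only [latticeNorm_eq_norm]
  refine h (fun n => WithLp.toLp 2 (fun i => (((B ^ n).mulVec ζ) i : ℂ))) ?_ ?_
  · intro n
    have hCH : B * B = A.trace • B - A.det • (1 : Matrix (Fin 2) (Fin 2) ℤ) := by
      ext i j
      rw [Matrix.sub_apply, Matrix.smul_apply, Matrix.smul_apply, smul_eq_mul, smul_eq_mul]
      fin_cases i <;> fin_cases j <;>
        simp [hB, Matrix.mul_apply, Fin.sum_univ_two, Matrix.trace_fin_two, Matrix.det_fin_two] <;>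
        ring
    have hrec : (B ^ (n + 2)).mulVec ζ =
        A.trace • (B ^ (n + 1)).mulVec ζ - A.det • (B ^ n).mulVec ζ := by
      rw [← Matrix.smul_mulVec, ← Matrix.smul_mulVec, ← Matrix.sub_mulVec]
      congr 1
      rw [pow_add B n 2, sq, hCH, pow_succ, mul_sub, mul_smul_comm, mul_smul_comm, mul_one]
    ext i
    simp only [PiLp.sub_apply, PiLp.smul_apply, smul_eq_mul, hrec, Pi.sub_apply, Pi.smul_apply]
    rw [hsum, hprod, Int.cast_sub, Int.cast_mul, Int.cast_mul]
  · intro n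
    refine le_trans (le_of_eq ?_) (T.le_opNorm _)
    congr 1
    ext i
    rw [pow_succ', ← Matrix.mulVec_mulVec]
    fin_cases i <;> simp [hT, Matrix.mulVec, dotProduct]

/-- The vector halfway between times m and n has norm at least 1, so the larger endpoint is
exponentially large in |n - m|. -/
lemma exists_log_orbit_lower_bound {A : Matrix (Fin 2) (Fin 2) ℤ} (hdet : A.det ≠ 0)
    (hA : NoRootOfUnityEigenvalue A) :
    ∃ c : ℝ, 0 < c ∧ ∀ ζ : Fin 2 → ℤ, (∀ n, (A.transpose ^ n).mulVec ζ ≠ 0) → ∀ m n : ℕ,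
      c * (|(n : ℤ) - m| + 1 : ℝ) ≤
        Real.log (1 + max (latticeNorm ((A.transpose ^ m).mulVec ζ))
          (latticeNorm ((A.transpose ^ n).mulVec ζ))) := by
  obtain ⟨C, ρ, hC, h0, h1, h⟩ := exists_latticeNorm_orbit_bound hdet hA
  set θ := -Real.log ρ with hθ
  have hθ0 : 0 < θ := neg_pos.2 (Real.log_neg h0 h1)
  set β := max 0 (Real.log (2 * C)) with hβ
  have hβ0 : 0 ≤ β := le_max_left _ _
  have hl2 : 0 < Real.log 2 := Real.log_pos one_lt_two
  -- Additive constants are absorbed into multiples of log(1 + Q), which is at least log 2.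
  set M := 2 / θ * (1 + β / Real.log 2) + 2 / Real.log 2 with hM
  have hM0 : 0 < M := by positivity
  refine ⟨M⁻¹, by positivity, fun ζ hζ => ?_⟩
  have main : ∀ m D : ℕ, (D + 1 : ℝ) ≤ M *
      Real.log (1 + max (latticeNorm ((A.transpose ^ m).mulVec ζ))
          (latticeNorm ((A.transpose ^ (m + D)).mulVec ζ))) := by
    intro m D
    set Q := max (latticeNorm ((A.transpose ^ m).mulVec ζ))
          (latticeNorm ((A.transpose ^ (m + D)).mulVec ζ)) with hQ
    have hQ1 : 1 ≤ Q := (one_le_latticeNorm (hζ m)).trans (le_max_left _ _)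
    have hlog : Real.log 2 ≤ Real.log (1 + Q) := Real.log_le_log two_pos (by linarith)
    obtain ⟨k, l, rfl, hkl, hD⟩ : ∃ k l, D = k + l ∧ k ≤ l ∧ l ≤ k + 1 :=
      ⟨D / 2, D - D / 2, by omega, by omega, by omega⟩
    have h2 : 1 ≤ 2 * C * ρ ^ k * Q := by
      calc 1 ≤ _ := one_le_latticeNorm (hζ (m + k))
        _ ≤ _ := h ζ m k l
        _ ≤ C * (ρ ^ k * Q + ρ ^ k * Q) := by
          have hpow := pow_le_pow_of_le_one h0.le h1.le hkl
          have hend : latticeNorm ((A.transpose ^ (m + k + l)).mulVec ζ) ≤ Q := by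
            rw [add_assoc]; exact le_max_right _ _
          have hstart : latticeNorm ((A.transpose ^ m).mulVec ζ) ≤ Q := le_max_left _ _
          have := Real.sqrt_nonneg (∑ i, (((A.transpose ^ (m + k + l)).mulVec ζ) i : ℝ) ^ 2)
          gcongr
        _ = _ := by ring
    have h3 : k * θ ≤ β + Real.log (1 + Q) := by
      have h4 := Real.log_nonneg h2
      rw [Real.log_mul (by positivity) (by positivity), Real.log_mul (by positivity) (by positivity),
        Real.log_pow] at h4
      have h5 : Real.log Q ≤ Real.log (1 + Q) := Real.log_le_log (by positivity) (by linarith)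
      have h6 : Real.log (2 * C) ≤ β := le_max_right _ _
      rw [hθ]; linarith
    have h7 : (l : ℝ) ≤ k + 1 := by exact_mod_cast hD
    set X := Real.log (1 + Q)
    have h8 : β ≤ β / Real.log 2 * X := by
      rw [div_mul_eq_mul_div, le_div_iff₀ hl2]; gcongr
    have h9 : 1 ≤ X / Real.log 2 := by rwa [le_div_iff₀ hl2, one_mul]
    have h10 : (k : ℝ) ≤ (X + β / Real.log 2 * X) / θ := by
      rw [le_div_iff₀ hθ0]; linarith
    calc ((k + l : ℕ) : ℝ) + 1 ≤ 2 * k + 2 * 1 := by push_cast; linarith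
      _ ≤ 2 * ((X + β / Real.log 2 * X) / θ) + 2 * (X / Real.log 2) := by gcongr
      _ = M * X := by rw [hM]; ring
  intro m n
  rw [inv_mul_le_iff₀ hM0]
  rcases le_total m n with hmn | hmn
  · obtain ⟨D, rfl⟩ := Nat.exists_eq_add_of_le hmn
    simpa using main m D
  · obtain ⟨D, rfl⟩ := Nat.exists_eq_add_of_le hmn
    rw [max_comm]
    simpa using main n D

lemma summable_int_abs_add_one_rpow {δ : ℝ} (hδ : 0 < δ) :
    Summable fun k : ℤ => ((|k| + 1 : ℝ) ^ (1 + δ))⁻¹ := by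
  have h : Summable fun k : ℕ => (((k : ℝ) + 1) ^ (1 + δ))⁻¹ := by
    have := (summable_nat_add_iff 1).2 (Real.summable_nat_rpow_inv.2 (by linarith : 1 < 1 + δ))
    simpa using this
  exact Summable.of_nat_of_neg (by simpa using h) (by simpa using h)

/-- The weights `log (1 + |ξ|) ^ (1 + δ)` are uniformly summable-inverse along orbits of the
transposed matrix. -/
lemma exists_sum_inv_log_rpow_le {A : Matrix (Fin 2) (Fin 2) ℤ} (hdet : A.det ≠ 0)
    (hA : NoRootOfUnityEigenvalue A) {δ : ℝ} (hδ : 0 < δ) :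
    ∃ C : ℝ, 0 ≤ C ∧ ∀ ζ : Fin 2 → ℤ, ζ ≠ 0 → ∀ F : Finset ℕ,
      ∑ n ∈ F, (Real.log (1 + latticeNorm ((A.transpose ^ n).mulVec ζ)) ^ (1 + δ))⁻¹ ≤ C := by
  obtain ⟨c, hc, h⟩ := exists_log_orbit_lower_bound hdet hA
  have hsum := summable_int_abs_add_one_rpow hδ
  refine ⟨(c ^ (1 + δ))⁻¹ * ∑' k : ℤ, ((|k| + 1 : ℝ) ^ (1 + δ))⁻¹,
    mul_nonneg (by positivity) (tsum_nonneg fun k => by positivity), fun ζ hζ F => ?_⟩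
  have hne : ∀ n, (A.transpose ^ n).mulVec ζ ≠ 0 := fun n h0 =>
    hζ (Matrix.eq_zero_of_mulVec_eq_zero (by simpa using pow_ne_zero n hdet) h0)
  rcases F.eq_empty_or_nonempty with rfl | hF
  · simpa using mul_nonneg (by positivity) (tsum_nonneg fun k => by positivity)
  -- With m of smallest norm in F, the maximum in the lower bound is always attained at n.
  obtain ⟨m, -, hm⟩ := F.exists_min_image
    (fun n => latticeNorm ((A.transpose ^ n).mulVec ζ)) hF
  calc _ ≤ ∑ n ∈ F, (c ^ (1 + δ))⁻¹ * ((|((n : ℤ) - m : ℤ)| + 1 : ℝ) ^ (1 + δ))⁻¹ := by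
        refine Finset.sum_le_sum fun n hn => ?_
        rw [← mul_inv, ← Real.mul_rpow hc.le (by positivity)]
        have := h ζ hne m n
        rw [max_eq_right (hm n hn)] at this
        push_cast at this ⊢
        gcongr
    _ = (c ^ (1 + δ))⁻¹ * ∑ k ∈ F.map ⟨fun n : ℕ => (n : ℤ) - m, fun x y hxy => by simpa using hxy⟩,
          ((|k| + 1 : ℝ) ^ (1 + δ))⁻¹ := by
        rw [Finset.sum_map, Finset.mul_sum]; rfl
    _ ≤ _ := by
        gcongr
        exact hsum.sum_le_tsum _ fun k _ => by positivity

/-! ### Toral endomorphisms and Haar measure. -/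

lemma toralMap_add (M : Matrix (Fin 2) (Fin 2) ℤ) (x y : UnitAddTorus (Fin 2)) :
    toralMap M (x + y) = toralMap M x + toralMap M y := by
  ext i
  simp only [toralMap, Pi.add_apply, smul_add, Finset.sum_add_distrib]

lemma toralMap_mul (M N : Matrix (Fin 2) (Fin 2) ℤ) (x : UnitAddTorus (Fin 2)) :
    toralMap (M * N) x = toralMap M (toralMap N x) := by
  ext i
  simp only [toralMap, Matrix.mul_apply, Fin.sum_univ_two, smul_add, add_smul, mul_smul]
  abel

lemma toralMap_smul_one (d : ℤ) (x : UnitAddTorus (Fin 2)) : toralMap (d • 1) x = d • x := by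
  ext i
  simp only [toralMap, Matrix.smul_apply, Matrix.one_apply, Pi.smul_apply, Fin.sum_univ_two]
  fin_cases i <;> simp

lemma continuous_toralMap (M : Matrix (Fin 2) (Fin 2) ℤ) : Continuous (toralMap M) := by
  unfold toralMap
  fun_prop

/-- The circle is divisible: divide by det M, then apply the adjugate. -/
lemma surjective_toralMap {M : Matrix (Fin 2) (Fin 2) ℤ} (hM : M.det ≠ 0) :
    Function.Surjective (toralMap M) := by
  intro y
  refine ⟨toralMap M.adjugate fun i => DivisibleBy.div (y i) M.det, ?_⟩
  rw [← toralMap_mul, Matrix.mul_adjugate, toralMap_smul_one]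
  ext i
  exact DivisibleBy.div_cancel (y i) hM

lemma measurePreserving_toralMap {M : Matrix (Fin 2) (Fin 2) ℤ} (hM : M.det ≠ 0) :
    MeasurePreserving (toralMap M) torusMeasure torusMeasure :=
  AddMonoidHom.measurePreserving (f := AddMonoidHom.mk' (toralMap M) (toralMap_add M))
    (continuous_toralMap M) (surjective_toralMap hM) rfl

/-! ### Fourier coefficients of compositions with toral endomorphisms. -/

namespace UnitAddTorus

lemma mFourier_transpose_mulVec (M : Matrix (Fin 2) (Fin 2) ℤ) (ξ : Fin 2 → ℤ)
    (x : UnitAddTorus (Fin 2)) :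
    mFourier (M.transpose.mulVec ξ) x = mFourier ξ (toralMap M x) := by
  simp only [mFourier, ContinuousMap.coe_mk, Fin.prod_univ_two, toralMap, Fin.sum_univ_two,
    fourier_apply, Matrix.mulVec, dotProduct, Matrix.transpose_apply, smul_add, add_smul,
    AddCircle.toCircle_add, Circle.coe_mul, smul_smul, mul_comm (ξ _)]
  ring

lemma mFourierCoeff_zero (f : UnitAddTorus (Fin 2) → ℂ) :
    mFourierCoeff f 0 = ∫ x, f x ∂torusMeasure := by
  refine integral_congr_ae (μ := torusMeasure) (Eventually.of_forall fun x => ?_)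
  simp [mFourier_zero]

lemma mFourierCoeff_const (c : ℂ) (ξ : Fin 2 → ℤ) :
    mFourierCoeff (fun _ : UnitAddTorus (Fin 2) => c) ξ = if ξ = 0 then c else 0 := by
  have h := (orthonormal_iff_ite.1 (orthonormal_mFourier (d := Fin 2))) ξ 0
  rw [ContinuousMap.inner_toLp] at h
  have h1 : mFourierCoeff (fun _ : UnitAddTorus (Fin 2) => c) ξ =
      (∫ x, mFourier (-ξ) x ∂torusMeasure) * c := by
    refine Eq.trans ?_ (integral_mul_const c _)
    rfl
  have h2 : ∫ x, mFourier (-ξ) x ∂torusMeasure = if ξ = 0 then 1 else 0 := by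
    refine Eq.trans ?_ h
    refine integral_congr_ae (μ := torusMeasure) (Eventually.of_forall fun x => ?_)
    simp [mFourier_zero, mFourier_neg]
  rw [h1, h2]
  split_ifs <;> simp

lemma mFourierCoeff_sub_const {f : UnitAddTorus (Fin 2) → ℂ} (hf : Integrable f torusMeasure)
    (c : ℂ) (ξ : Fin 2 → ℤ) :
    mFourierCoeff (fun x => f x - c) ξ = mFourierCoeff f ξ - if ξ = 0 then c else 0 := by
  have hint : ∀ {h : UnitAddTorus (Fin 2) → ℂ}, Integrable h torusMeasure →
      Integrable (fun x => mFourier (-ξ) x • h x) torusMeasure := fun hh =>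
    hh.bdd_mul (c := 1) (mFourier (-ξ)).continuous.aestronglyMeasurable
      (Eventually.of_forall fun x => ((mFourier (-ξ)).norm_coe_le_norm x).trans mFourier_norm.le)
  rw [← mFourierCoeff_const]
  refine Eq.trans ?_ (integral_sub (hint hf) (hint (integrable_const c)))
  exact integral_congr_ae (μ := torusMeasure)
    (Eventually.of_forall fun x => by simp only [smul_sub])

lemma hasSum_sq_mFourierCoeff_of_memLp {g : UnitAddTorus (Fin 2) → ℂ}
    (hg : MemLp g 2 torusMeasure) :
    HasSum (fun ξ => ‖mFourierCoeff g ξ‖ ^ 2) (∫ x, ‖g x‖ ^ 2 ∂torusMeasure) := by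
  have h : HasSum (fun ξ => ‖mFourierCoeff (hg.toLp g) ξ‖ ^ 2)
      (∫ x, ‖hg.toLp g x‖ ^ 2 ∂torusMeasure) := hasSum_sq_mFourierCoeff (hg.toLp g)
  have hae := hg.coeFn_toLp
  have h1 : ∫ x, ‖hg.toLp g x‖ ^ 2 ∂torusMeasure = ∫ x, ‖g x‖ ^ 2 ∂torusMeasure :=
    integral_congr_ae (by filter_upwards [hae] with x hx; rw [hx])
  have h2 : ∀ ξ, mFourierCoeff (hg.toLp g) ξ = mFourierCoeff g ξ := fun ξ =>
    integral_congr_ae (μ := torusMeasure) (by filter_upwards [hae] with x hx; rw [hx])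
  rw [h1] at h
  simpa only [h2] using h

lemma mFourierCoeff_comp_toralMap {M : Matrix (Fin 2) (Fin 2) ℤ} (hM : M.det ≠ 0)
    {g : UnitAddTorus (Fin 2) → ℂ} (hg : AEStronglyMeasurable g torusMeasure) (ξ : Fin 2 → ℤ) :
    mFourierCoeff (fun x => g (toralMap M x)) (M.transpose.mulVec ξ) = mFourierCoeff g ξ := by
  have hT := measurePreserving_toralMap hM
  have hmeas : AEStronglyMeasurable (fun x => mFourier (-ξ) x • g x) torusMeasure :=
    (mFourier (-ξ)).continuous.aestronglyMeasurable.smul hg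
  have h : ∫ x, mFourier (-ξ) x • g x ∂torusMeasure =
      ∫ x, mFourier (-ξ) (toralMap M x) • g (toralMap M x) ∂torusMeasure := by
    conv_lhs => rw [← hT.map_eq]
    exact integral_map hT.measurable.aemeasurable (hT.map_eq.symm ▸ hmeas)
  refine Eq.trans ?_ h.symm
  refine integral_congr_ae (μ := torusMeasure) (Eventually.of_forall fun x => ?_)
  simp only [← Matrix.mulVec_neg, mFourier_transpose_mulVec]

lemma mulVec_injective_of_det_ne_zero {M : Matrix (Fin 2) (Fin 2) ℤ} (hM : M.det ≠ 0) :
    Function.Injective M.mulVec := fun x y hxy =>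
  sub_eq_zero.1 <| Matrix.eq_zero_of_mulVec_eq_zero hM (by rw [Matrix.mulVec_sub, hxy, sub_self])

/-- The frequencies of `g ∘ M` lie in the image of the transpose of `M`. -/
lemma mFourierCoeff_comp_toralMap_eq_zero {M : Matrix (Fin 2) (Fin 2) ℤ} (hM : M.det ≠ 0)
    {g : UnitAddTorus (Fin 2) → ℂ} (hg : MemLp g 2 torusMeasure) {ξ : Fin 2 → ℤ}
    (hξ : ξ ∉ Set.range M.transpose.mulVec) :
    mFourierCoeff (fun x => g (toralMap M x)) ξ = 0 := by
  have hT := measurePreserving_toralMap hM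
  have hinj : Function.Injective M.transpose.mulVec :=
    mulVec_injective_of_det_ne_zero (by rwa [Matrix.det_transpose])
  have h1 := hasSum_sq_mFourierCoeff_of_memLp hg
  have h2 := hasSum_sq_mFourierCoeff_of_memLp (hg.comp_measurePreserving hT)
  -- By Parseval and invariance of the measure, the coefficients on the range already exhaust the
  -- norm of g ∘ M, so nothing is left outside it.
  have h3 : ∫ x, ‖(g ∘ toralMap M) x‖ ^ 2 ∂torusMeasure = ∫ x, ‖g x‖ ^ 2 ∂torusMeasure := by
    conv_rhs => rw [← hT.map_eq]
    exact (integral_map (f := fun x => ‖g x‖ ^ 2) hT.measurable.aemeasurable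
      (hT.map_eq.symm ▸ hg.1.norm.pow 2)).symm
  rw [h3] at h2
  set a := fun ξ => ‖mFourierCoeff (g ∘ toralMap M) ξ‖ ^ 2 with ha
  have h4 : HasSum (a ∘ M.transpose.mulVec) (∫ x, ‖g x‖ ^ 2 ∂torusMeasure) := by
    refine h1.congr_fun fun ζ => ?_
    simp only [ha, Function.comp_apply]
    rw [← mFourierCoeff_comp_toralMap hM hg.1]
    rfl
  set R := Set.range M.transpose.mulVec with hR
  have h5 : HasSum (fun ζ : R => a ζ)
      (∫ x, ‖g x‖ ^ 2 ∂torusMeasure) := by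
    rw [← (Equiv.ofInjective _ hinj).hasSum_iff]
    exact h4
  have h6 := (h2.summable.subtype Rᶜ).hasSum
  have h7 := h2.unique (h5.add_compl h6)
  rw [left_eq_add.1 h7] at h6
  have h8 := (hasSum_zero_iff_of_nonneg fun ζ : Subtype Rᶜ =>
    sq_nonneg ‖mFourierCoeff (g ∘ toralMap M) ζ‖).1 h6
  have h9 : a ξ = 0 := congrFun h8 ⟨ξ, hξ⟩
  exact norm_eq_zero.1 ((pow_eq_zero_iff two_ne_zero).1 h9)

end UnitAddTorus

/-! ### Almost orthogonality of the iterates. -/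

open UnitAddTorus in
/-- Sums of a function along the orbit are almost orthogonal in `L²`, as soon as its Fourier
coefficients have logarithmically weighted square sums. -/
lemma exists_integral_sq_orbit_sum_le {A : Matrix (Fin 2) (Fin 2) ℤ} (hdet : A.det ≠ 0)
    (hA : NoRootOfUnityEigenvalue A) {g : UnitAddTorus (Fin 2) → ℂ} (hg : MemLp g 2 torusMeasure)
    (hg0 : mFourierCoeff g 0 = 0) {δ : ℝ} (hδ : 0 < δ)
    (hcoeff : Summable fun ξ : Fin 2 → ℤ =>
      Real.log (1 + latticeNorm ξ) ^ (1 + δ) * ‖mFourierCoeff g ξ‖ ^ 2) :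
    ∃ C : ℝ, 0 ≤ C ∧ ∀ F : Finset ℕ,
      ∫ x, ‖∑ n ∈ F, g (toralMap (A ^ n) x)‖ ^ 2 ∂torusMeasure ≤ C * F.card := by
  obtain ⟨C, hC, h⟩ := exists_sum_inv_log_rpow_le hdet hA hδ
  set w : (Fin 2 → ℤ) → ℝ := fun ξ => Real.log (1 + latticeNorm ξ) ^ (1 + δ) with hw
  have hw0 : ∀ ξ, 0 ≤ w ξ := fun ξ =>
    Real.rpow_nonneg (Real.log_nonneg (le_add_of_nonneg_right (Real.sqrt_nonneg _))) _
  have hwpos : ∀ ξ, ξ ≠ 0 → 0 < w ξ := fun ξ hξ =>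
    Real.rpow_pos_of_pos (Real.log_pos (by linarith [one_le_latticeNorm hξ])) _
  set K := ∑' ξ, w ξ * ‖mFourierCoeff g ξ‖ ^ 2
  have hK : 0 ≤ K := tsum_nonneg fun ξ => mul_nonneg (hw0 ξ) (sq_nonneg _)
  have hdetn : ∀ n, (A ^ n).det ≠ 0 := fun n => by rw [Matrix.det_pow]; exact pow_ne_zero n hdet
  have hinj : ∀ n, Function.Injective (A.transpose ^ n).mulVec := fun n =>
    mulVec_injective_of_det_ne_zero (by rw [← Matrix.transpose_pow, Matrix.det_transpose]; exact hdetn n)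
  set a : ℕ → (Fin 2 → ℤ) → ℂ := fun n => mFourierCoeff (fun x => g (toralMap (A ^ n) x)) with ha
  have ha1 : ∀ n ζ, a n ((A.transpose ^ n).mulVec ζ) = mFourierCoeff g ζ := fun n ζ => by
    rw [← Matrix.transpose_pow]; exact mFourierCoeff_comp_toralMap (hdetn n) hg.1 ζ
  have ha2 : ∀ n ξ, ξ ∉ Set.range (A.transpose ^ n).mulVec → a n ξ = 0 := fun n ξ hξ =>
    mFourierCoeff_comp_toralMap_eq_zero (hdetn n) hg (by rwa [Matrix.transpose_pow])
  -- The weighted mass of g transported by (Aᵀ)^n; its total is K for every n.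
  set b : ℕ → (Fin 2 → ℤ) → ℝ := fun n =>
    Function.extend (A.transpose ^ n).mulVec (fun ζ => w ζ * ‖mFourierCoeff g ζ‖ ^ 2) 0 with hb
  have hb1 : ∀ n ζ, b n ((A.transpose ^ n).mulVec ζ) = w ζ * ‖mFourierCoeff g ζ‖ ^ 2 :=
    fun n ζ => (hinj n).extend_apply _ _ _
  have hb2 : ∀ n ξ, ξ ∉ Set.range (A.transpose ^ n).mulVec → b n ξ = 0 := fun n ξ hξ =>
    Function.extend_apply' _ _ _ hξ
  have hb0 : ∀ n ξ, 0 ≤ b n ξ := fun n ξ => by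
    by_cases hξ : ξ ∈ Set.range (A.transpose ^ n).mulVec
    · obtain ⟨ζ, rfl⟩ := hξ
      rw [hb1]; exact mul_nonneg (hw0 ζ) (sq_nonneg _)
    · rw [hb2 n ξ hξ]
  have hbsum : ∀ n, HasSum (b n) K := fun n => by
    rw [← (hinj n).hasSum_iff (hb2 n)]
    exact hcoeff.hasSum.congr_fun (hb1 n)
  have hmem : ∀ n, MemLp (fun x => g (toralMap (A ^ n) x)) 2 torusMeasure := fun n =>
    hg.comp_measurePreserving (measurePreserving_toralMap (hdetn n))
  refine ⟨C * K, by positivity, fun F => ?_⟩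
  have hS := hasSum_sq_mFourierCoeff_of_memLp (memLp_finsetSum F fun n _ => hmem n)
  have hcoef : ∀ ξ, mFourierCoeff (fun x => ∑ n ∈ F, g (toralMap (A ^ n) x)) ξ = ∑ n ∈ F, a n ξ := by
    intro ξ
    have h1 : ∀ n ∈ F, Integrable (fun x => mFourier (-ξ) x • g (toralMap (A ^ n) x))
        torusMeasure := fun n _ =>
      ((hmem n).integrable one_le_two).bdd_mul (c := 1)
        (mFourier (-ξ)).continuous.aestronglyMeasurable
        (Eventually.of_forall fun x => ((mFourier (-ξ)).norm_coe_le_norm x).trans mFourier_norm.le)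
    refine Eq.trans ?_ (integral_finsetSum F h1)
    exact integral_congr_ae (μ := torusMeasure)
      (Eventually.of_forall fun x => by simp only [Finset.smul_sum])
  simp only [hcoef] at hS
  have hright : HasSum (fun ξ => C * ∑ n ∈ F, b n ξ) (C * ∑ n ∈ F, K) :=
    (hasSum_sum fun n _ => hbsum n).mul_left C
  refine (hasSum_le (fun ξ => ?_) hS hright).trans_eq (by
    rw [Finset.sum_const, nsmul_eq_mul]; ring)
  -- The weight vanishes at the zero frequency, where the vanishing mean is used instead.
  by_cases hξ0 : ξ = 0
  · have : ∀ n, a n ξ = 0 := fun n => by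
      have := ha1 n 0
      rwa [Matrix.mulVec_zero, hg0, ← hξ0] at this
    simp only [this, Finset.sum_const_zero, norm_zero, ne_eq, two_ne_zero, not_false_eq_true,
      zero_pow]
    exact mul_nonneg hC (Finset.sum_nonneg fun n _ => hb0 n ξ)
  classical
  set F' := F.filter fun n => ξ ∈ Set.range (A.transpose ^ n).mulVec with hF'
  have hsumF : ∑ n ∈ F, a n ξ = ∑ n ∈ F', a n ξ := by
    refine (Finset.sum_subset (Finset.filter_subset _ _) fun n hn hn' => ha2 n ξ fun hr => ?_).symm
    exact hn' (Finset.mem_filter.2 ⟨hn, hr⟩)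
  have hle : ∑ n ∈ F', b n ξ ≤ ∑ n ∈ F, b n ξ :=
    Finset.sum_le_sum_of_subset_of_nonneg (Finset.filter_subset _ _) fun n _ _ => hb0 n ξ
  rw [hsumF]
  refine le_trans ?_ (mul_le_mul_of_nonneg_left hle hC)
  rcases F'.eq_empty_or_nonempty with he | hne
  · simp [he]
  -- The preimage ζ of ξ at the latest time m generates all the others: at time n the preimage is
  -- (Aᵀ)^(m - n) ζ. The weights involved thus lie on one forward orbit.
  obtain ⟨m, hm, hmax⟩ := F'.exists_max_image id hne
  obtain ⟨ζ, hζ⟩ := (Finset.mem_filter.1 hm).2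
  have hζ0 : ζ ≠ 0 := by rintro rfl; exact hξ0 (by rw [← hζ, Matrix.mulVec_zero])
  have hpre : ∀ n ∈ F', ξ = (A.transpose ^ n).mulVec ((A.transpose ^ (m - n)).mulVec ζ) := by
    intro n hn
    have hnm : n ≤ m := hmax n hn
    rw [Matrix.mulVec_mulVec, ← pow_add, Nat.add_sub_cancel' hnm, hζ]
  have hwn : ∀ n, 0 < w ((A.transpose ^ n).mulVec ζ) := fun n =>
    hwpos _ fun h0 => hζ0 (hinj n (by rw [h0, Matrix.mulVec_zero]))
  have hCS : (∑ n ∈ F', ‖a n ξ‖) ^ 2 ≤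
      (∑ n ∈ F', (w ((A.transpose ^ (m - n)).mulVec ζ))⁻¹) * ∑ n ∈ F', b n ξ := by
    refine Finset.sum_sq_le_sum_mul_sum_of_sq_le_mul F' (fun n _ => (inv_pos.2 (hwn _)).le)
      (fun n _ => hb0 n ξ) fun n hn => le_of_eq ?_
    rw [hpre n hn, ha1, hb1, inv_mul_cancel_left₀ (hwn _).ne']
  have hweights : ∑ n ∈ F', (w ((A.transpose ^ (m - n)).mulVec ζ))⁻¹ ≤ C := by
    have himg : Set.InjOn (fun n => m - n) (F' : Set ℕ) := fun x hx y hy hxy => by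
      have h1 : x ≤ m := hmax x hx
      have h2 : y ≤ m := hmax y hy
      simp only at hxy
      omega
    have := h ζ hζ0 (F'.image fun n => m - n)
    rwa [Finset.sum_image himg] at this
  calc _ ≤ (∑ n ∈ F', ‖a n ξ‖) ^ 2 := by gcongr; exact norm_sum_le _ _
    _ ≤ _ := hCS
    _ ≤ _ := mul_le_mul_of_nonneg_right hweights (Finset.sum_nonneg fun n _ => hb0 n ξ)

/-! ### The Rademacher–Menshov argument. -/

/-- The sum of the squared norms of all dyadic blocks of a sequence inside `[0, 2 ^ k)`. -/
noncomputable def dyadicSquareSum (u : ℕ → ℂ) (k : ℕ) : ℝ :=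
  ∑ j ∈ Finset.range k, ∑ i ∈ Finset.range (2 ^ (k - j)),
    ‖∑ n ∈ Finset.Ico (i * 2 ^ j) ((i + 1) * 2 ^ j), u n‖ ^ 2

/-- The Rademacher–Menshov inequality for a single sequence. -/
lemma norm_sum_range_sq_le_dyadicSquareSum (u : ℕ → ℂ) {k N : ℕ} (hN : N < 2 ^ k) :
    ‖∑ n ∈ Finset.range N, u n‖ ^ 2 ≤ k * dyadicSquareSum u k := by
  set S : ℕ → ℂ := fun N => ∑ n ∈ Finset.range N, u n with hS
  -- The last j binary digits of N are cleared. Each difference D j - D (j + 1) is zero or a single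
  -- dyadic block, according to the digit j, and D k = 0.
  set D : ℕ → ℂ := fun j => S (N / 2 ^ j * 2 ^ j) with hD
  have htel : S N = ∑ j ∈ Finset.range k, (D j - D (j + 1)) := by
    rw [Finset.sum_range_sub']
    simp [hD, hS, Nat.div_eq_of_lt hN]
  have hblock : ∀ j ∈ Finset.range k, ‖D j - D (j + 1)‖ ^ 2 ≤
      ∑ i ∈ Finset.range (2 ^ (k - j)),
        ‖∑ n ∈ Finset.Ico (i * 2 ^ j) ((i + 1) * 2 ^ j), u n‖ ^ 2 := by
    intro j hj
    have hjk : j < k := Finset.mem_range.1 hj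
    set q := N / 2 ^ j with hq
    have hq' : N / 2 ^ (j + 1) = q / 2 := by rw [pow_succ, ← Nat.div_div_eq_div_mul]
    have hqlt : q < 2 ^ (k - j) := by
      rw [hq, Nat.div_lt_iff_lt_mul (by positivity), ← pow_add, Nat.sub_add_cancel hjk.le]
      exact hN
    have hval : D (j + 1) = S (q / 2 * 2 * 2 ^ j) := by
      simp only [hD, hq']; congr 1; ring
    rcases Nat.even_or_odd q with he | ho
    · rw [hval, Nat.div_mul_cancel he.two_dvd]
      simp only [hD, ← hq, sub_self, norm_zero]
      exact (by positivity : (0 : ℝ) ≤ _).trans' (by norm_num)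
    · have hodd : q / 2 * 2 + 1 = q := by rw [mul_comm]; exact Nat.two_mul_div_two_add_one_of_odd ho
      have heq : D j - D (j + 1) =
          ∑ n ∈ Finset.Ico (q / 2 * 2 * 2 ^ j) ((q / 2 * 2 + 1) * 2 ^ j), u n := by
        rw [hval, Finset.sum_Ico_eq_sub _ (Nat.mul_le_mul_right _ (Nat.le_succ _)),
          Nat.succ_eq_add_one, hodd]
      rw [heq]
      exact Finset.single_le_sum
        (f := fun i => ‖∑ n ∈ Finset.Ico (i * 2 ^ j) ((i + 1) * 2 ^ j), u n‖ ^ 2)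
        (fun i _ => by positivity) (Finset.mem_range.2 (by omega : q / 2 * 2 < 2 ^ (k - j)))
  calc ‖S N‖ ^ 2 ≤ (∑ j ∈ Finset.range k, ‖D j - D (j + 1)‖) ^ 2 := by
        rw [htel]; gcongr; exact norm_sum_le _ _
    _ ≤ (Finset.range k).card * ∑ j ∈ Finset.range k, ‖D j - D (j + 1)‖ ^ 2 :=
        sq_sum_le_card_mul_sum_sq
    _ ≤ k * dyadicSquareSum u k := by
        rw [Finset.card_range]
        gcongr
        exact Finset.sum_le_sum hblock

lemma dyadicSquareSum_nonneg (u : ℕ → ℂ) (k : ℕ) : 0 ≤ dyadicSquareSum u k :=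
  Finset.sum_nonneg fun _ _ => Finset.sum_nonneg fun _ _ => sq_nonneg _

/-- If the `L²` norm of the sum of the terms of index in `F` is `O(√|F|)`, then the partial sums
are almost surely `o(√N (log N) ^ (3/2 + η))`. -/
lemma ae_tendsto_of_integral_sq_sum_le {Ω : Type*} [MeasurableSpace Ω] {μ : Measure Ω}
    {X : ℕ → Ω → ℂ} (hX : ∀ n, MemLp (X n) 2 μ) {C : ℝ}
    (hC : ∀ F : Finset ℕ, ∫ x, ‖∑ n ∈ F, X n x‖ ^ 2 ∂μ ≤ C * F.card) {η : ℝ} (hη : 0 < η) :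
    ∀ᵐ x ∂μ, Tendsto (fun N : ℕ => √(N : ℝ) / Real.log (1 + (N : ℝ)) ^ (3 / 2 + η) *
      ‖(1 / (N : ℂ)) * ∑ n ∈ Finset.range N, X n x‖) atTop (𝓝 0) := by
  have hint : ∀ F : Finset ℕ, Integrable (fun x => ‖∑ n ∈ F, X n x‖ ^ 2) μ := fun F =>
    (memLp_finsetSum F fun n _ => hX n).integrable_norm_pow two_ne_zero
  have hYint : ∀ k, Integrable (fun x => dyadicSquareSum (fun n => X n x) k) μ := fun k =>
    integrable_finsetSum _ fun j _ => integrable_finsetSum _ fun i _ => hint _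
  have hY : ∀ k, ∫ x, dyadicSquareSum (fun n => X n x) k ∂μ ≤ C * k * 2 ^ k := by
    intro k
    unfold dyadicSquareSum
    rw [integral_finsetSum _ fun j _ => integrable_finsetSum _ fun i _ => hint _]
    calc _ ≤ ∑ j ∈ Finset.range k, C * 2 ^ k := by
          refine Finset.sum_le_sum fun j hj => ?_
          rw [integral_finsetSum _ fun i _ => hint _]
          calc _ ≤ ∑ i ∈ Finset.range (2 ^ (k - j)), C * 2 ^ j := by
                refine Finset.sum_le_sum fun i _ => (hC _).trans_eq ?_
                rw [Nat.card_Ico, ← Nat.sub_mul]; simp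
            _ = C * 2 ^ k := by
                rw [Finset.sum_const, Finset.card_range, nsmul_eq_mul]
                push_cast
                rw [mul_left_comm, ← pow_add, Nat.sub_add_cancel (Finset.mem_range.1 hj).le]
      _ = _ := by rw [Finset.sum_const, Finset.card_range, nsmul_eq_mul]; ring
  -- The exponent 3 + 2η pays one factor k for Cauchy–Schwarz over the levels, one for the number of
  -- levels, and k^(1 + 2η) for summability.
  set Z : ℕ → Ω → ℝ := fun k x =>
    k / (2 ^ k * (k : ℝ) ^ (3 + 2 * η)) * dyadicSquareSum (fun n => X n x) k with hZ
  have hZ0 : ∀ k x, 0 ≤ Z k x := fun k x =>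
    mul_nonneg (by positivity) (dyadicSquareSum_nonneg _ _)
  have hZint : ∀ k, Integrable (Z k) μ := fun k => (hYint k).const_mul _
  have hZsum : Summable fun k => ∫ x, Z k x ∂μ := by
    have hs := (Real.summable_nat_rpow_inv.2 (by linarith : 1 < 1 + 2 * η)).mul_left C
    refine Summable.of_nonneg_of_le (fun k => integral_nonneg (hZ0 k)) (fun k => ?_) hs
    rw [hZ, integral_const_mul]
    rcases Nat.eq_zero_or_pos k with rfl | hk
    · simp [Real.zero_rpow (by linarith : 1 + 2 * η ≠ 0)]
    have hk' : (0 : ℝ) < k := by exact_mod_cast hk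
    calc _ ≤ k / (2 ^ k * (k : ℝ) ^ (3 + 2 * η)) * (C * k * 2 ^ k) := by gcongr; exact hY k
      _ = C * ((k : ℝ) ^ (1 + 2 * η))⁻¹ := by
        rw [show 3 + 2 * η = (1 + 2 * η) + 2 by ring, Real.rpow_add hk', Real.rpow_two]
        field_simp
  have hae : ∀ᵐ x ∂μ, Tendsto (fun k => Z k x) atTop (𝓝 0) := by
    have h1 : ∑' k, ∫⁻ x, ENNReal.ofReal (Z k x) ∂μ ≠ ⊤ := by
      simp_rw [← ofReal_integral_eq_lintegral_ofReal (hZint _) (Eventually.of_forall (hZ0 _))]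
      exact hZsum.tsum_ofReal_ne_top
    rw [← lintegral_tsum fun k => (hZint k).1.aemeasurable.ennreal_ofReal] at h1
    have h2 := ae_lt_top' (AEMeasurable.tsum fun k =>
      (hZint k).1.aemeasurable.ennreal_ofReal) h1
    filter_upwards [h2] with x hx
    have h3 := ENNReal.tendsto_atTop_zero_of_tsum_ne_top hx.ne
    have h4 := (ENNReal.tendsto_toReal ENNReal.zero_ne_top).comp h3
    simpa [Function.comp_def, ENNReal.toReal_ofReal (hZ0 _ x)] using h4
  filter_upwards [hae] with x hx
  -- For N of binary length k, the 2 comes from 2^k ≤ 2N and the other factor from k (log 2) / 2 ≤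
  -- log(1 + N).
  set c : ℝ := 2 / (Real.log 2 / 2) ^ (3 + 2 * η) with hc
  have hl2 : 0 < Real.log 2 := Real.log_pos one_lt_two
  have hsize : Tendsto Nat.size atTop atTop :=
    tendsto_atTop_mono (fun N => Nat.size_le_size le_rfl) (by
      refine tendsto_atTop_atTop.2 fun b => ⟨2 ^ b, fun N hN => ?_⟩
      exact (Nat.lt_size.2 hN).le)
  have hlim : Tendsto (fun N => √(c * Z (Nat.size N) x)) atTop (𝓝 0) := by
    have := ((hx.comp hsize).const_mul c).sqrt
    simpa using this
  refine squeeze_zero' (Eventually.of_forall fun N => ?_) ?_ hlim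
  · have : 0 ≤ Real.log (1 + (N : ℝ)) := Real.log_nonneg (by simp)
    positivity
  filter_upwards [eventually_ge_atTop 1] with N hN
  refine Real.le_sqrt_of_sq_le ?_
  set k := Nat.size N with hk
  have hN0 : (0 : ℝ) < N := by exact_mod_cast hN
  have hkpos : 0 < k := Nat.size_pos.2 hN
  have hk0 : (0 : ℝ) < k := by exact_mod_cast hkpos
  have hub : N < 2 ^ k := Nat.lt_size_self N
  have hlb : (2 : ℝ) ^ k ≤ 2 * N := by
    have : 2 ^ (k - 1) ≤ N := Nat.lt_size.1 (by omega)
    have h2 : 2 ^ k ≤ 2 * N := by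
      obtain ⟨j, hj⟩ : ∃ j, k = j + 1 := ⟨k - 1, by omega⟩
      rw [hj] at this ⊢
      simp at this
      rw [pow_succ]; omega
    exact_mod_cast h2
  have hlog : k * (Real.log 2 / 2) ≤ Real.log (1 + N) := by
    have h1 : (2 : ℝ) ^ k ≤ (1 + N) ^ 2 := by nlinarith
    have h2 := Real.log_le_log (by positivity) h1
    rw [Real.log_pow, Real.log_pow] at h2
    push_cast at h2
    linarith
  have hlog0 : 0 < Real.log (1 + (N : ℝ)) := lt_of_lt_of_le (by positivity) hlog
  have hM := norm_sum_range_sq_le_dyadicSquareSum (fun n => X n x) hub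
  have hYn := dyadicSquareSum_nonneg (fun n => X n x) k
  calc _ = ‖∑ n ∈ Finset.range N, X n x‖ ^ 2 / (N * Real.log (1 + (N : ℝ)) ^ (3 + 2 * η)) := by
        rw [norm_mul, norm_div, norm_one, Complex.norm_natCast, mul_pow, mul_pow, div_pow,
          Real.sq_sqrt hN0.le, ← Real.rpow_mul_natCast hlog0.le]
        rw [show (3 / 2 + η) * ((2 : ℕ) : ℝ) = 3 + 2 * η by push_cast; ring]
        field_simp
    _ ≤ (k * dyadicSquareSum (fun n => X n x) k) /
        (2 ^ k / 2 * (k * (Real.log 2 / 2)) ^ (3 + 2 * η)) := by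
        gcongr
        linarith
    _ = c * Z k x := by
        rw [Real.mul_rpow hk0.le (by positivity), hc, hZ]
        field_simp

/-! ### Reduction to mean zero and conclusion. -/

open UnitAddTorus in
theorem theorem1p6 (A : Matrix (Fin 2) (Fin 2) ℤ) (hdet : A.det ≠ 0)
    (hA : NoRootOfUnityEigenvalue A)
    (f : UnitAddTorus (Fin 2) → ℂ) (hf : MemLp f 2 torusMeasure)
    (δ : ℝ) (hδ : 0 < δ)
    (hcoeff : Summable fun ξ : Fin 2 → ℤ =>
      Real.log (1 + latticeNorm ξ) ^ (1 + δ) * ‖UnitAddTorus.mFourierCoeff f ξ‖ ^ 2)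
    (η : ℝ) (hη : 0 < η) :
    ∀ᵐ x ∂torusMeasure,
      Tendsto
        (fun N : ℕ => √(N : ℝ) / Real.log (1 + (N : ℝ)) ^ (3 / 2 + η) *
          ‖(1 / (N : ℂ)) * ∑ n ∈ Finset.range N, f (toralMap (A ^ n) x)
            - ∫ y, f y ∂torusMeasure‖)
        atTop (𝓝 0) := by
  set m := ∫ y, f y ∂torusMeasure with hm
  set g : UnitAddTorus (Fin 2) → ℂ := fun x => f x - m with hg
  have hgL : MemLp g 2 torusMeasure := hf.sub (memLp_const m)
  have hsub := mFourierCoeff_sub_const (hf.integrable one_le_two) m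
  have hg0 : mFourierCoeff g 0 = 0 := by
    rw [hg, hsub, mFourierCoeff_zero, if_pos rfl, ← hm, sub_self]
  have hgcoeff : Summable fun ξ : Fin 2 → ℤ =>
      Real.log (1 + latticeNorm ξ) ^ (1 + δ) * ‖mFourierCoeff g ξ‖ ^ 2 := by
    refine hcoeff.congr fun ξ => ?_
    rcases eq_or_ne ξ 0 with rfl | hξ
    -- The weight at ξ = 0 is 0, so removing the mean does not affect the sum.
    · simp [latticeNorm, Real.zero_rpow (by linarith : 1 + δ ≠ 0)]
    · rw [hg, hsub, if_neg hξ, sub_zero]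
  obtain ⟨C, -, hC⟩ := exists_integral_sq_orbit_sum_le hdet hA hgL hg0 hδ hgcoeff
  have hX : ∀ n, MemLp (fun x => g (toralMap (A ^ n) x)) 2 torusMeasure := fun n =>
    hgL.comp_measurePreserving
      (measurePreserving_toralMap (by rw [Matrix.det_pow]; exact pow_ne_zero n hdet))
  filter_upwards [ae_tendsto_of_integral_sq_sum_le hX hC hη] with x hx
  refine hx.congr' ?_
  -- The averages agree only for N ≥ 1, since 1 / 0 = 0 loses the mean at N = 0.
  filter_upwards [eventually_ge_atTop 1] with N hN
  have hN0 : (N : ℂ) ≠ 0 := by exact_mod_cast (by omega : N ≠ 0)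
  congr 2
  simp only [hg, Finset.sum_sub_distrib, Finset.sum_const, Finset.card_range, nsmul_eq_mul]
  field_simp
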